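/- For an integer $N\ge 3$ put $a_N=\frac{4(N-1)}{N-2}$ and $p_N=\frac{2N}{N-2}$. Let $m,n\ge 1$ be integers with $m+n\ge 4$, let $p=p_{m+n}$, and let $U$ be the radial ground state on $\mathbb{R}^n$, i.e. a positive $C^2$ solution, radial around the origin and of finite energy ($\int_{\mathbb{R}^n}U^2<\infty$ and $\int_{\mathbb{R}^n}|\nabla U|^2<\infty$), of $$-\Delta U+U=U^{p-1}\quad\text{in }\mathbb{R}^n .$$ Set $$\beta=\int_{\mathbb{R}^n}U^2\,dz-\frac{a_{m+n}}{n(n+2)}\int_{\mathbb{R}^n}|\nabla U|^2|z|^2\,dz .$$ 1. If $m+n=4$, then $\beta<0$. 2. If $n\neq 4$ and $m+n>4$, then $$\beta=\frac{6-a_{m+n}}{n(n-4)}\int_{\mathbb{R}^n}\left(\frac{2}{p}\cdot\frac{m}{m+n-4}\,U^p-U^2\right)|z|^2\,dz .$$ In both cases the integrals that appear converge absolutely. -/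

import Mathlib

open MeasureTheory
open scoped ContDiff Gradient Laplacian

noncomputable section

/-- The constant `a_N = 4 (N - 1) / (N - 2)` of the Yamabe equation in dimension `N`. -/
def yamabeConst (N : ℕ) : ℝ := 4 * ((N : ℝ) - 1) / ((N : ℝ) - 2)

/-- The exponent `p_N = 2 N / (N - 2)` of the Yamabe equation in dimension `N`. -/
def yamabeExp (N : ℕ) : ℝ := 2 * (N : ℝ) / ((N : ℝ) - 2)

/-- `U` is a positive, finite-energy (that is, `H¹`) classical solution of
`-ΔU + U = U ^ (q - 1)` on `ℝⁿ`, radial around the origin. -/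
structure IsRadialGroundState {n : ℕ} (q : ℝ) (U : EuclideanSpace ℝ (Fin n) → ℝ) : Prop where
  contDiff : ContDiff ℝ 2 U
  pos : ∀ z, 0 < U z
  radial : ∀ y z, ‖y‖ = ‖z‖ → U y = U z
  integrable_sq : Integrable (fun z => U z ^ 2) volume
  integrable_grad_sq : Integrable (fun z => ‖∇ U z‖ ^ 2) volume
  equation : ∀ z, -(Δ U z) + U z = U z ^ (q - 1)

/-- The number `β = ∫ U² - a_{m+n} / (n (n + 2)) ∫ |∇U|² |z|²`. -/
def yamabeBeta {n : ℕ} (m : ℕ) (U : EuclideanSpace ℝ (Fin n) → ℝ) : ℝ :=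
  (∫ z, U z ^ 2) -
    yamabeConst (m + n) / ((n : ℝ) * ((n : ℝ) + 2)) * ∫ z, ‖∇ U z‖ ^ 2 * ‖z‖ ^ 2

end

open Set Filter Topology Asymptotics

/-- `u`, with derivative `v`, is a positive solution on `(0, ∞)` of the radial equation
`u'' + (k / r) u' = u - u ^ (q - 1)` whose energy in dimension `k + 1` is finite. -/
structure IsRadialProfile (k : ℕ) (q : ℝ) (u v : ℝ → ℝ) : Prop where
  hasDerivAt : ∀ r, HasDerivAt u (v r) r
  continuous_deriv : Continuous v
  pos : ∀ r, 0 < u r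
  hasDerivAt_deriv : ∀ r, 0 < r → HasDerivAt v (u r - u r ^ (q - 1) - k / r * v r) r
  integrableOn_sq : IntegrableOn (fun r => r ^ k * u r ^ 2) (Ioi 0)
  integrableOn_deriv_sq : IntegrableOn (fun r => r ^ k * v r ^ 2) (Ioi 0)

namespace IsRadialProfile

variable {k : ℕ} {q : ℝ} {u v : ℝ → ℝ}

theorem continuous (h : IsRadialProfile k q u v) : Continuous u :=
  continuous_iff_continuousAt.2 fun r => (h.hasDerivAt r).continuousAt

theorem integrableOn_Ioi_one_of_pow_mul {f : ℝ → ℝ} (hf : Continuous f)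
    (hi : IntegrableOn (fun r => r ^ k * f r ^ 2) (Ioi 0)) :
    IntegrableOn (fun r => f r ^ 2) (Ioi 1) := by
  refine Integrable.mono' (hi.mono_set (Ioi_subset_Ioi zero_le_one))
    (by fun_prop) ?_
  filter_upwards [ae_restrict_mem measurableSet_Ioi] with r hr
  rw [Real.norm_of_nonneg (sq_nonneg _)]
  exact le_mul_of_one_le_left (sq_nonneg _) (one_le_pow₀ (le_of_lt hr))

theorem tendsto_zero (h : IsRadialProfile k q u v) : Tendsto u atTop (𝓝 0) := by
  have hu := h.continuous
  have hv := h.continuous_deriv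
  have hiu := integrableOn_Ioi_one_of_pow_mul hu h.integrableOn_sq
  have hiv := integrableOn_Ioi_one_of_pow_mul hv h.integrableOn_deriv_sq
  have hsq : Tendsto (fun r => u r ^ 2) atTop (𝓝 0) := by
    refine tendsto_zero_of_hasDerivAt_of_integrableOn_Ioi (a := 1)
      (f' := fun r => 2 * u r * v r) (fun r _ => ?_) ?_ hiu
    · simpa using (h.hasDerivAt r).fun_pow 2
    · refine Integrable.mono' (hiu.add hiv) (by fun_prop) (Eventually.of_forall fun r => ?_)
      simp only [Pi.add_apply, Real.norm_eq_abs]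
      rw [abs_le]
      constructor <;> nlinarith [sq_nonneg (u r + v r), sq_nonneg (u r - v r)]
  have := hsq.sqrt
  simpa [Real.sqrt_sq (h.pos _).le] using this

/-- Far out, the nonlinear term is at most half of the linear one. -/
theorem exists_rpow_le_half (h : IsRadialProfile k q u v) (hq : 2 < q) :
    ∃ R, 1 ≤ R ∧ ∀ r, R ≤ r → u r ^ (q - 1) ≤ u r / 2 := by
  have h1 : Tendsto (fun r => u r ^ (q - 2)) atTop (𝓝 0) := by
    have := h.tendsto_zero.rpow_const (p := q - 2) (Or.inr (by linarith))
    rwa [Real.zero_rpow (by linarith)] at this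
  obtain ⟨R, hR⟩ := eventually_atTop.1 (h1.eventually_le_const (u := (1 / 2 : ℝ)) (by norm_num))
  refine ⟨max R 1, le_max_right _ _, fun r hr => ?_⟩
  have h2 := hR r ((le_max_left _ _).trans hr)
  have h3 : u r ^ (q - 1) = u r ^ (q - 2) * u r := by
    rw [show q - 1 = (q - 2) + 1 by ring, Real.rpow_add (h.pos r), Real.rpow_one]
  rw [h3]
  nlinarith [h.pos r]

theorem hasDerivAt_pow_mul_deriv (h : IsRadialProfile k q u v) {r : ℝ} (hr : 0 < r) :
    HasDerivAt (fun s => s ^ k * v s) (r ^ k * (u r - u r ^ (q - 1))) r := by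
  refine ((hasDerivAt_pow k r).mul (h.hasDerivAt_deriv r hr)).congr_deriv ?_
  rcases k with _ | k
  · simp
  · simp only [Nat.add_sub_cancel]
    field_simp
    ring

theorem deriv_nonpos (h : IsRadialProfile k q u v) {R : ℝ} (hR : 1 ≤ R)
    (hs : ∀ r, R ≤ r → u r ^ (q - 1) ≤ u r / 2) {r : ℝ} (hr : R ≤ r) : v r ≤ 0 := by
  have hmono : MonotoneOn (fun s => s ^ k * v s) (Ici R) := by
    refine monotoneOn_of_hasDerivWithinAt_nonneg (convex_Ici R)
      ((continuous_pow k).mul h.continuous_deriv).continuousOn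
      (f' := fun r => r ^ k * (u r - u r ^ (q - 1))) ?_ ?_
    · intro s hs'
      rw [interior_Ici] at hs'
      have : 0 < s := by have : R < s := hs'; linarith
      exact (h.hasDerivAt_pow_mul_deriv this).hasDerivWithinAt
    · intro s hs'
      rw [interior_Ici] at hs'
      have h0 : R < s := hs'
      have := hs s h0.le
      have := h.pos s
      exact mul_nonneg (pow_nonneg (by linarith) _) (by linarith)
  by_contra! hv
  have hpos : ∀ s, r ≤ s → 0 < v s := by
    intro s hrs
    have h1 := hmono (show r ∈ Ici R from hr) (show s ∈ Ici R from hr.trans hrs) hrs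
    have h2 : 0 < r ^ k * v r := mul_pos (pow_pos (by linarith) _) hv
    exact (mul_pos_iff_of_pos_left (pow_pos (by linarith) k)).1 (h2.trans_le h1)
  have hm : MonotoneOn u (Ici r) := by
    refine monotoneOn_of_hasDerivWithinAt_nonneg (convex_Ici r) h.continuous.continuousOn
      (f' := v) (fun s _ => (h.hasDerivAt s).hasDerivWithinAt) ?_
    intro s hs'
    rw [interior_Ici] at hs'
    exact (hpos s (le_of_lt hs')).le
  have := ge_of_tendsto h.tendsto_zero ((eventually_ge_atTop r).mono fun s hrs =>
    hm self_mem_Ici (show s ∈ Ici r from hrs) hrs)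
  exact absurd (h.pos r) (not_lt.2 this)

theorem sq_le_two_mul_deriv_sq (h : IsRadialProfile k q u v) {R : ℝ} (hR : 1 ≤ R)
    (hs : ∀ r, R ≤ r → u r ^ (q - 1) ≤ u r / 2) {r : ℝ} (hr : R ≤ r) :
    u r ^ 2 / 2 ≤ v r ^ 2 := by
  have hanti : AntitoneOn (fun s => v s ^ 2 - u s ^ 2 / 2) (Ici R) := by
    refine antitoneOn_of_hasDerivWithinAt_nonpos (convex_Ici R)
      ((h.continuous_deriv.pow 2).sub ((h.continuous.pow 2).div_const 2)).continuousOn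
      (f' := fun s => 2 * v s * (u s - u s ^ (q - 1) - k / s * v s) - u s * v s) ?_ ?_
    · intro s hs'
      rw [interior_Ici] at hs'
      have : 0 < s := by have : R < s := hs'; linarith
      refine HasDerivAt.hasDerivWithinAt ?_
      refine (((h.hasDerivAt_deriv s this).pow 2).sub
        (((h.hasDerivAt s).pow 2).div_const 2)).congr_deriv ?_
      push_cast
      ring
    · intro s hs'
      rw [interior_Ici] at hs'
      have h0 : R < s := hs'
      have h1 := hs s h0.le
      have h2 := h.deriv_nonpos hR hs h0.le
      have h3 : 0 ≤ (k : ℝ) / s := div_nonneg (Nat.cast_nonneg k) (by linarith)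
      have h4 := mul_nonneg h3 (sq_nonneg (v s))
      have h5 := mul_nonneg (neg_nonneg.2 h2) (sub_nonneg.2 h1)
      linarith
  have hlim : Tendsto (fun s => -(u s ^ 2 / 2)) atTop (𝓝 0) := by
    simpa using ((h.tendsto_zero.pow 2).div_const 2).neg
  have := le_of_tendsto hlim ((eventually_ge_atTop r).mono fun s hrs => by
    have h1 := hanti (show r ∈ Ici R from hr) (show s ∈ Ici R from hr.trans hrs) hrs
    have h2 := sq_nonneg (v s)
    exact (show -(u s ^ 2 / 2) ≤ v r ^ 2 - u r ^ 2 / 2 by simp only at h1; linarith))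
  linarith

theorem deriv_le_neg_half (h : IsRadialProfile k q u v) {R : ℝ} (hR : 1 ≤ R)
    (hs : ∀ r, R ≤ r → u r ^ (q - 1) ≤ u r / 2) {r : ℝ} (hr : R ≤ r) :
    v r ≤ -(u r / 2) := by
  have h1 := h.deriv_nonpos hR hs hr
  have h2 := h.sq_le_two_mul_deriv_sq hR hs hr
  nlinarith [h.pos r]

theorem le_mul_exp (h : IsRadialProfile k q u v) {R : ℝ} (hR : 1 ≤ R)
    (hs : ∀ r, R ≤ r → u r ^ (q - 1) ≤ u r / 2) {r : ℝ} (hr : R ≤ r) :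
    u r ≤ u R * Real.exp (R / 2) * Real.exp (-(1 / 2) * r) := by
  have hanti : AntitoneOn (fun s => u s * Real.exp (s / 2)) (Ici R) := by
    refine antitoneOn_of_hasDerivWithinAt_nonpos (convex_Ici R)
      (h.continuous.mul (by fun_prop)).continuousOn
      (f' := fun s => v s * Real.exp (s / 2) + u s * (Real.exp (s / 2) * (1 / 2))) ?_ ?_
    · intro s _
      exact ((h.hasDerivAt s).mul ((hasDerivAt_id s).div_const 2).exp).hasDerivWithinAt
    · intro s hs'
      rw [interior_Ici] at hs'
      have h1 := h.deriv_le_neg_half hR hs (le_of_lt hs')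
      have := Real.exp_pos (s / 2)
      nlinarith
  have h1 := hanti self_mem_Ici (show r ∈ Ici R from hr) hr
  simp only at h1
  calc u r = u r * Real.exp (r / 2) * Real.exp (-(1 / 2) * r) := by
        rw [mul_assoc, ← Real.exp_add]; ring_nf; simp
    _ ≤ _ := by gcongr

theorem isBigO_exp (h : IsRadialProfile k q u v) (hq : 2 < q) :
    u =O[atTop] fun r => Real.exp (-(1 / 2) * r) := by
  obtain ⟨R, hR, hs⟩ := h.exists_rpow_le_half hq
  refine IsBigO.of_bound (u R * Real.exp (R / 2)) ((eventually_ge_atTop R).mono fun r hr => ?_)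
  rw [Real.norm_of_nonneg (h.pos r).le, Real.norm_of_nonneg (Real.exp_pos _).le]
  exact h.le_mul_exp hR hs hr

theorem deriv_isBigO_exp (h : IsRadialProfile k q u v) (hq : 2 < q) :
    v =O[atTop] fun r => Real.exp (-(1 / 2) * r) := by
  obtain ⟨R, hR, hs⟩ := h.exists_rpow_le_half hq
  have hmono : MonotoneOn v (Ici R) := by
    refine monotoneOn_of_hasDerivWithinAt_nonneg (convex_Ici R) h.continuous_deriv.continuousOn
      (f' := fun r => u r - u r ^ (q - 1) - k / r * v r) ?_ ?_
    · intro s hs'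
      rw [interior_Ici] at hs'
      have : 0 < s := by have : R < s := hs'; linarith
      exact (h.hasDerivAt_deriv s this).hasDerivWithinAt
    · intro s hs'
      rw [interior_Ici] at hs'
      have h0 : R < s := hs'
      have h1 := hs s h0.le
      have h2 := h.deriv_nonpos hR hs h0.le
      have h3 : 0 ≤ (k : ℝ) / s := div_nonneg (Nat.cast_nonneg k) (by linarith)
      have h4 := mul_nonneg h3 (neg_nonneg.2 h2)
      have := h.pos s
      linarith
  refine IsBigO.of_bound (u R * Real.exp (R / 2) * Real.exp (1 / 2))
    ((eventually_ge_atTop (R + 1)).mono fun r hr => ?_)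
  rw [Real.norm_of_nonneg (Real.exp_pos _).le,
    Real.norm_of_nonpos (h.deriv_nonpos hR hs (by linarith))]
  obtain ⟨c, ⟨hc1, hc2⟩, hc⟩ := exists_hasDerivAt_eq_slope u v (show r - 1 < r by linarith)
    h.continuous.continuousOn fun x _ => h.hasDerivAt x
  have h1 : v c ≤ v r := hmono (show R ≤ c by linarith) (show R ≤ r by linarith) hc2.le
  have h2 := h.le_mul_exp hR hs (show R ≤ r - 1 by linarith)
  have h3 : v c = u r - u (r - 1) := by rw [hc]; simp
  have h4 : Real.exp (1 / 2) * Real.exp (-(1 / 2) * r) = Real.exp (-(1 / 2) * (r - 1)) := by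
    rw [← Real.exp_add]; ring_nf
  rw [mul_assoc, h4]
  linarith [h.pos r]

theorem mul_isBigO_exp {f g : ℝ → ℝ} (hf : f =O[atTop] fun r => Real.exp (-(1 / 2) * r))
    (hg : g =O[atTop] fun r => Real.exp (-(1 / 2) * r)) :
    (fun r => f r * g r) =O[atTop] fun r => Real.exp (-(1 / 2) * r) := by
  refine (hf.mul hg).trans (IsBigO.of_bound 1 ((eventually_ge_atTop 0).mono fun r hr => ?_))
  rw [← Real.exp_add, Real.norm_of_nonneg (Real.exp_pos _).le,
    Real.norm_of_nonneg (Real.exp_pos _).le, one_mul, Real.exp_le_exp]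
  linarith

theorem pow_mul_isBigO_exp (j : ℕ) {f : ℝ → ℝ}
    (hf : f =O[atTop] fun r => Real.exp (-(1 / 2) * r)) :
    (fun r => r ^ j * f r) =O[atTop] fun r => Real.exp (-(1 / 4) * r) := by
  have h1 := (isLittleO_pow_exp_pos_mul_atTop j (b := 1 / 4) (by norm_num)).isBigO.mul hf
  refine h1.congr_right fun r => ?_
  rw [← Real.exp_add]
  ring_nf

theorem integrableOn_pow_mul (j : ℕ) {f : ℝ → ℝ} (hc : Continuous f)
    (hf : f =O[atTop] fun r => Real.exp (-(1 / 2) * r)) :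
    IntegrableOn (fun r => r ^ j * f r) (Ioi 0) :=
  integrable_of_isBigO_exp_neg (b := 1 / 4) (by norm_num)
    ((continuous_pow j).mul hc).continuousOn (pow_mul_isBigO_exp j hf)

theorem tendsto_pow_mul_zero (j : ℕ) {f : ℝ → ℝ}
    (hf : f =O[atTop] fun r => Real.exp (-(1 / 2) * r)) :
    Tendsto (fun r => r ^ j * f r) atTop (𝓝 0) := by
  refine (pow_mul_isBigO_exp j hf).trans_tendsto ?_
  refine Real.tendsto_exp_atBot.comp ?_
  exact tendsto_id.const_mul_atTop_of_neg (by norm_num)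

theorem sq_isBigO_exp (h : IsRadialProfile k q u v) (hq : 2 < q) :
    (fun r => u r ^ 2) =O[atTop] fun r => Real.exp (-(1 / 2) * r) := by
  simpa only [sq] using mul_isBigO_exp (h.isBigO_exp hq) (h.isBigO_exp hq)

theorem deriv_sq_isBigO_exp (h : IsRadialProfile k q u v) (hq : 2 < q) :
    (fun r => v r ^ 2) =O[atTop] fun r => Real.exp (-(1 / 2) * r) := by
  simpa only [sq] using mul_isBigO_exp (h.deriv_isBigO_exp hq) (h.deriv_isBigO_exp hq)

theorem rpow_isBigO_exp (h : IsRadialProfile k q u v) (hq : 2 < q) :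
    (fun r => u r ^ q) =O[atTop] fun r => Real.exp (-(1 / 2) * r) := by
  obtain ⟨R, hR, hs⟩ := h.exists_rpow_le_half hq
  refine (IsBigO.of_bound 1 ((eventually_ge_atTop R).mono fun r hr => ?_)).trans
    (h.sq_isBigO_exp hq)
  have h1 : u r ^ q = u r ^ (q - 1) * u r := by
    rw [← Real.rpow_add_one (h.pos r).ne', sub_add_cancel]
  have h2 := hs r hr
  have h3 := h.pos r
  rw [Real.norm_of_nonneg (Real.rpow_nonneg h3.le _), Real.norm_of_nonneg (sq_nonneg _), h1]
  nlinarith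

theorem continuous_rpow (h : IsRadialProfile k q u v) : Continuous fun r => u r ^ q :=
  h.continuous.rpow_const fun r => Or.inl (h.pos r).ne'

theorem integrableOn_pow_mul_sq (h : IsRadialProfile k q u v) (hq : 2 < q) (j : ℕ) :
    IntegrableOn (fun r => r ^ j * u r ^ 2) (Ioi 0) :=
  integrableOn_pow_mul j (h.continuous.pow 2) (h.sq_isBigO_exp hq)

theorem integrableOn_pow_mul_deriv_sq (h : IsRadialProfile k q u v) (hq : 2 < q) (j : ℕ) :
    IntegrableOn (fun r => r ^ j * v r ^ 2) (Ioi 0) :=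
  integrableOn_pow_mul j (h.continuous_deriv.pow 2) (h.deriv_sq_isBigO_exp hq)

theorem integrableOn_pow_mul_rpow (h : IsRadialProfile k q u v) (hq : 2 < q) (j : ℕ) :
    IntegrableOn (fun r => r ^ j * u r ^ q) (Ioi 0) :=
  integrableOn_pow_mul j h.continuous_rpow (h.rpow_isBigO_exp hq)

/-- The radial equation tested with `r ^ 2 * u`. -/
theorem integral_mul_self_identity (h : IsRadialProfile k q u v) (hq : 2 < q) :
    (∫ r in Ioi 0, r ^ (k + 2) * v r ^ 2) + (∫ r in Ioi 0, r ^ (k + 2) * u r ^ 2) -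
      (∫ r in Ioi 0, r ^ (k + 2) * u r ^ q) =
      ((k : ℝ) + 1) * ∫ r in Ioi 0, r ^ k * u r ^ 2 := by
  have iv := h.integrableOn_pow_mul_deriv_sq hq (k + 2)
  have iu := h.integrableOn_pow_mul_sq hq (k + 2)
  have ip := h.integrableOn_pow_mul_rpow hq (k + 2)
  have is : IntegrableOn (fun r => r ^ (k + 2) * v r ^ 2 + r ^ (k + 2) * u r ^ 2 -
      r ^ (k + 2) * u r ^ q) (Ioi 0) := (iv.fun_add iu).sub ip
  have i0 := (h.integrableOn_pow_mul_sq hq k).const_mul ((k : ℝ) + 1)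
  have hu := h.continuous
  have hv := h.continuous_deriv
  have key := integral_Ioi_of_hasDerivAt_of_tendsto (a := 0) (m := 0)
    (f := fun r => r ^ (k + 2) * (u r * v r) - r ^ (k + 1) * u r ^ 2)
    (f' := fun r => r ^ (k + 2) * v r ^ 2 + r ^ (k + 2) * u r ^ 2 - r ^ (k + 2) * u r ^ q -
      ((k : ℝ) + 1) * (r ^ k * u r ^ 2))
    (by fun_prop) ?_ (is.sub i0) ?_
  · rw [integral_sub (is) i0, integral_sub (iv.fun_add iu) ip, integral_add iv iu,
      integral_const_mul] at key
    simp at key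
    linarith
  · intro r hr
    refine (((hasDerivAt_pow (k + 2) r).mul ((h.hasDerivAt r).mul
      (h.hasDerivAt_deriv r hr))).sub
      ((hasDerivAt_pow (k + 1) r).mul ((h.hasDerivAt r).pow 2))).congr_deriv ?_
    have h1 : u r ^ q = u r ^ (q - 1) * u r := by
      rw [← Real.rpow_add_one (h.pos r).ne', sub_add_cancel]
    have hr0 : r ≠ 0 := (show 0 < r from hr).ne'
    rw [h1]
    simp only [Nat.add_sub_cancel, show k + 2 - 1 = k + 1 from rfl, Pi.mul_apply, Pi.pow_apply]
    push_cast
    field_simp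
    ring
  · simpa using (tendsto_pow_mul_zero (k + 2)
      (mul_isBigO_exp (h.isBigO_exp hq) (h.deriv_isBigO_exp hq))).sub
      (tendsto_pow_mul_zero (k + 1) (h.sq_isBigO_exp hq))

/-- The weighted Pohozaev identity: the radial equation tested with `r ^ 3 * u'`. -/
theorem integral_pohozaev_identity (h : IsRadialProfile k q u v) (hq : 2 < q) :
    ((k : ℝ) - 3) * (∫ r in Ioi 0, r ^ (k + 2) * v r ^ 2) =
      ((k : ℝ) + 3) * (2 / q * (∫ r in Ioi 0, r ^ (k + 2) * u r ^ q) -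
        ∫ r in Ioi 0, r ^ (k + 2) * u r ^ 2) := by
  have iv := (h.integrableOn_pow_mul_deriv_sq hq (k + 2)).const_mul (((k : ℝ) - 3))
  have iu := (h.integrableOn_pow_mul_sq hq (k + 2)).const_mul ((k : ℝ) + 3)
  have ip := (h.integrableOn_pow_mul_rpow hq (k + 2)).const_mul (((k : ℝ) + 3) * (2 / q))
  have hu := h.continuous
  have hv := h.continuous_deriv
  have hp := h.continuous_rpow
  have hq0 : q ≠ 0 := by linarith
  have key := integral_Ioi_of_hasDerivAt_of_tendsto (a := 0) (m := 0)
    (f := fun r => r ^ (k + 3) * u r ^ 2 - r ^ (k + 3) * v r ^ 2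
      - 2 / q * (r ^ (k + 3) * u r ^ q))
    (f' := fun r => ((k : ℝ) - 3) * (r ^ (k + 2) * v r ^ 2) +
      ((k : ℝ) + 3) * (r ^ (k + 2) * u r ^ 2) -
      ((k : ℝ) + 3) * (2 / q) * (r ^ (k + 2) * u r ^ q))
    (by fun_prop) ?_ ?_ ?_
  · rw [integral_sub (iv.fun_add iu) ip, integral_add iv iu,
      integral_const_mul, integral_const_mul, integral_const_mul] at key
    simp at key
    linarith
  · intro r hr
    have hr0 : r ≠ 0 := (show 0 < r from hr).ne'
    have hpw := hasDerivAt_pow (k + 3) r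
    refine (((hpw.mul ((h.hasDerivAt r).pow 2)).sub
      (hpw.mul ((h.hasDerivAt_deriv r hr).pow 2))).sub
      ((hpw.mul ((h.hasDerivAt r).rpow_const (p := q)
        (Or.inl (h.pos r).ne'))).const_mul (2 / q))).congr_deriv ?_
    simp only [show k + 3 - 1 = k + 2 from rfl, Pi.pow_apply]
    push_cast
    field_simp
    ring
  · exact (iv.fun_add iu).sub ip
  · simpa using ((tendsto_pow_mul_zero (k + 3) (h.sq_isBigO_exp hq)).sub
      (tendsto_pow_mul_zero (k + 3) (h.deriv_sq_isBigO_exp hq))).sub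
      ((tendsto_pow_mul_zero (k + 3) (h.rpow_isBigO_exp hq)).const_mul (2 / q))

end IsRadialProfile

section RadialFunction

variable {E : Type*} [NormedAddCommGroup E] [InnerProductSpace ℝ E]
  {U : E → ℝ} {u : ℝ → ℝ} {u' : ℝ}

theorem hasFDerivAt_of_radial (hU : ∀ z, U z = u ‖z‖) {z : E} (hz : z ≠ 0)
    (hu : HasDerivAt u u' ‖z‖) : HasFDerivAt U ((u' / ‖z‖) • innerSL ℝ z) z := by
  have hz' : ‖z‖ ≠ 0 := norm_ne_zero_iff.2 hz
  have h1 := (hasStrictFDerivAt_norm_sq z).hasFDerivAt.sqrt (pow_ne_zero 2 hz')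
  simp only [Real.sqrt_sq (norm_nonneg _)] at h1
  have h2 := hu.comp_hasFDerivAt z h1
  rw [show U = u ∘ fun x => ‖x‖ from funext hU]
  refine h2.congr_fderiv ?_
  ext w
  simp
  field_simp

variable [CompleteSpace E]

theorem norm_gradient_of_radial (hU : ∀ z, U z = u ‖z‖) {z : E} (hz : z ≠ 0)
    (hu : HasDerivAt u u' ‖z‖) : ‖∇ U z‖ = |u'| := by
  have hz' : ‖z‖ ≠ 0 := norm_ne_zero_iff.2 hz
  rw [gradient, LinearIsometryEquiv.norm_map, (hasFDerivAt_of_radial hU hz hu).fderiv, norm_smul,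
    innerSL_apply_norm, norm_div, norm_norm, div_mul_cancel₀ _ hz', Real.norm_eq_abs]

end RadialFunction

section RadialLaplacian

variable {E : Type*} [NormedAddCommGroup E] [InnerProductSpace ℝ E] {U : E → ℝ}

theorem hasDerivAt_fderiv_line (hU : ContDiff ℝ 2 U) (z w : E) (t : ℝ) :
    HasDerivAt (fun s : ℝ => fderiv ℝ U (z + s • w) w)
      (fderiv ℝ (fderiv ℝ U) (z + t • w) w w) t := by
  have h1 : Differentiable ℝ (fderiv ℝ U) :=
    (hU.fderiv_right (m := 1) (by norm_num)).differentiable (by norm_num)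
  have h2 : HasDerivAt (fun s : ℝ => z + s • w) w t := by
    simpa using ((hasDerivAt_id t).smul_const w).const_add z
  have h3 := (h1 (z + t • w)).hasFDerivAt.comp_hasDerivAt t h2
  simpa using h3.clm_apply (hasDerivAt_const t w)

/-- In a direction tangent to the sphere, the second derivative of `u ‖z‖` is `u' / r`. -/
theorem fderiv_fderiv_of_radial_of_inner_eq_zero (hU : ContDiff ℝ 2 U) {u v : ℝ → ℝ}
    (hr : ∀ z, U z = u ‖z‖) (hu : ∀ r, HasDerivAt u (v r) r) (hv : Continuous v) {z w : E}
    (hz : z ≠ 0) (hw : ‖w‖ = 1) (hzw : inner ℝ z w = 0) :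
    fderiv ℝ (fderiv ℝ U) z w w = v ‖z‖ / ‖z‖ := by
  have h1 := hasDerivAt_fderiv_line hU z w 0
  rw [zero_smul, add_zero] at h1
  have hc : Continuous fun t : ℝ => z + t • w := by fun_prop
  have hne : ∀ᶠ t : ℝ in 𝓝 0, z + t • w ≠ 0 :=
    hc.continuousAt.eventually_ne (by simpa using hz)
  have heq : ∀ᶠ t : ℝ in 𝓝 0, fderiv ℝ U (z + t • w) w =
      v ‖z + t • w‖ / ‖z + t • w‖ * t := by
    filter_upwards [hne] with t ht
    rw [(hasFDerivAt_of_radial hr ht (hu _)).fderiv]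
    simp [hzw, hw]
  have hlim : Tendsto (fun t : ℝ => v ‖z + t • w‖ / ‖z + t • w‖) (𝓝 0) (𝓝 (v ‖z‖ / ‖z‖)) := by
    have : ContinuousAt (fun t : ℝ => v ‖z + t • w‖ / ‖z + t • w‖) 0 :=
      (hv.comp hc.norm).continuousAt.div hc.norm.continuousAt (by simpa using hz)
    simpa [ContinuousAt] using this
  refine h1.unique (hasDerivAt_iff_tendsto_slope.2 ?_)
  refine (hlim.mono_left nhdsWithin_le_nhds).congr' ?_
  filter_upwards [heq.filter_mono nhdsWithin_le_nhds, self_mem_nhdsWithin] with t ht ht0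
  have ht0' : t ≠ 0 := ht0
  rw [slope_def_field, ht, heq.self_of_nhds]
  field_simp
  simp

theorem laplacian_of_radial [FiniteDimensional ℝ E] {k : ℕ}
    (b : OrthonormalBasis (Fin (k + 1)) ℝ E) (hU : ContDiff ℝ 2 U) {u v : ℝ → ℝ}
    (hr : ∀ z, U z = u ‖z‖) (hu : ∀ r, HasDerivAt u (v r) r) (hv : Continuous v) {r : ℝ}
    (h0 : 0 < r) :
    (Δ U) (r • b 0) = fderiv ℝ (fderiv ℝ U) (r • b 0) (b 0) (b 0) + k / r * v r := by
  have hnorm : ‖r • b 0‖ = r := by simp [norm_smul, abs_of_pos h0]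
  have hne : r • b 0 ≠ 0 := by rw [← norm_ne_zero_iff, hnorm]; exact h0.ne'
  rw [InnerProductSpace.laplacian_eq_iteratedFDeriv_orthonormalBasis U b]
  simp only [iteratedFDeriv_two_apply, Fin.sum_univ_succ]
  congr 1
  have : ∀ i : Fin k, fderiv ℝ (fderiv ℝ U) (r • b 0) (b i.succ) (b i.succ) = v r / r := by
    intro i
    rw [fderiv_fderiv_of_radial_of_inner_eq_zero hU hr hu hv hne (by simp), hnorm]
    rw [inner_smul_left, b.orthonormal.2 (Fin.succ_ne_zero i).symm, mul_zero]
  simp [this]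
  ring

end RadialLaplacian

section PolarCoordinates

variable {k : ℕ}

theorem integrable_radial_iff {f : ℝ → ℝ} :
    Integrable (fun z : EuclideanSpace ℝ (Fin (k + 1)) => f ‖z‖) ↔
      IntegrableOn (fun r => r ^ k * f r) (Ioi 0) := by
  simpa using integrable_fun_norm_addHaar
    (volume : Measure (EuclideanSpace ℝ (Fin (k + 1)))) (f := f)

/-- The surface area of the unit sphere of `ℝ ^ (k + 1)`. -/
noncomputable def unitSphereArea (k : ℕ) : ℝ :=
  ((k : ℝ) + 1) *
    (volume : Measure (EuclideanSpace ℝ (Fin (k + 1)))).real (Metric.ball 0 1)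

theorem unitSphereArea_pos : 0 < unitSphereArea k := by
  refine mul_pos (by positivity) (ENNReal.toReal_pos ?_ ?_)
  · exact (Metric.measure_ball_pos _ _ one_pos).ne'
  · exact measure_ball_lt_top.ne

theorem integral_radial (f : ℝ → ℝ) :
    ∫ z : EuclideanSpace ℝ (Fin (k + 1)), f ‖z‖ =
      unitSphereArea k * ∫ r in Ioi 0, r ^ k * f r := by
  have := integral_fun_norm_addHaar (volume : Measure (EuclideanSpace ℝ (Fin (k + 1)))) f
  simp [unitSphereArea] at this ⊢
  rw [this]
  ring

end PolarCoordinates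

namespace IsRadialGroundState

variable {k : ℕ} {q : ℝ} {U : EuclideanSpace ℝ (Fin (k + 1)) → ℝ}

theorem exists_profile (h : IsRadialGroundState q U) :
    ∃ u v : ℝ → ℝ, IsRadialProfile k q u v ∧ (∀ z, U z = u ‖z‖) ∧
      ∀ᵐ z, ‖∇ U z‖ ^ 2 = v ‖z‖ ^ 2 := by
  set b := EuclideanSpace.basisFun (Fin (k + 1)) ℝ
  have hline := hasDerivAt_fderiv_line h.contDiff 0 (b 0)
  simp only [zero_add] at hline
  set u : ℝ → ℝ := fun r => U (r • b 0)
  set v : ℝ → ℝ := fun r => fderiv ℝ U (r • b 0) (b 0)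
  have hr : ∀ z, U z = u ‖z‖ := fun z => h.radial _ _ (by simp [norm_smul])
  have hu : ∀ r, HasDerivAt u (v r) r := by
    intro r
    have h1 := (h.contDiff.differentiable (by norm_num) (r • b 0)).hasFDerivAt
    have h2 : HasDerivAt (fun s : ℝ => s • b 0) (b 0) r := by
      simpa using (hasDerivAt_id r).smul_const (b 0)
    exact h1.comp_hasDerivAt r h2
  have hv : Continuous v := continuous_iff_continuousAt.2 fun r => (hline r).continuousAt
  have hgrad : ∀ᵐ z, ‖∇ U z‖ ^ 2 = v ‖z‖ ^ 2 := by
    filter_upwards [compl_mem_ae_iff.2 (measure_singleton (0 : EuclideanSpace ℝ (Fin (k + 1))))]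
      with z hz
    rw [norm_gradient_of_radial hr hz (hu _), sq_abs]
  refine ⟨u, v, ⟨hu, hv, fun r => h.pos _, fun r h0 => ?_, ?_, ?_⟩, hr, hgrad⟩
  · refine (hline r).congr_deriv ?_
    have h1 := h.equation (r • b 0)
    rw [laplacian_of_radial b h.contDiff hr hu hv h0] at h1
    change _ + u r = u r ^ (q - 1) at h1
    linarith
  · refine integrable_radial_iff.1 (h.integrable_sq.congr (Eventually.of_forall fun z => ?_))
    simp only [hr]
  · exact (integrable_radial_iff (f := fun r => v r ^ 2)).1 (h.integrable_grad_sq.congr hgrad)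

end IsRadialGroundState

theorem two_lt_yamabeExp {N : ℕ} (hN : 3 ≤ N) : 2 < yamabeExp N := by
  have h1 : (3 : ℝ) ≤ N := by exact_mod_cast hN
  rw [yamabeExp, lt_div_iff₀ (by linarith)]
  linarith

theorem IsRadialProfile.integral_pow_mul_rpow_pos {k : ℕ} {q : ℝ} {u v : ℝ → ℝ}
    (h : IsRadialProfile k q u v) (hq : 2 < q) (j : ℕ) :
    0 < ∫ r in Ioi 0, r ^ j * u r ^ q := by
  have hpos : ∀ r ∈ Ioi (0 : ℝ), 0 < r ^ j * u r ^ q := fun r hr =>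
    mul_pos (pow_pos hr j) (Real.rpow_pos_of_pos (h.pos r) q)
  rw [setIntegral_pos_iff_support_of_nonneg_ae _ (h.integrableOn_pow_mul_rpow hq j)]
  · rw [inter_eq_right.2 fun r hr => Function.mem_support.2 (hpos r hr).ne']
    simp
  · filter_upwards [ae_restrict_mem measurableSet_Ioi] with r hr using (hpos r hr).le

theorem theorem6p1 (m n : ℕ) (hm : 1 ≤ m) (hn : 1 ≤ n)
    (U : EuclideanSpace ℝ (Fin n) → ℝ) (hU : IsRadialGroundState (yamabeExp (m + n)) U) :
    (m + n = 4 →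
      Integrable (fun z => ‖∇ U z‖ ^ 2 * ‖z‖ ^ 2) volume ∧
      yamabeBeta m U < 0) ∧
    (n ≠ 4 → 4 < m + n →
      Integrable (fun z => ‖∇ U z‖ ^ 2 * ‖z‖ ^ 2) volume ∧
      Integrable (fun z => U z ^ 2 * ‖z‖ ^ 2) volume ∧
      Integrable (fun z => U z ^ yamabeExp (m + n) * ‖z‖ ^ 2) volume ∧
      yamabeBeta m U =
        (6 - yamabeConst (m + n)) / ((n : ℝ) * ((n : ℝ) - 4)) *
          ∫ z, (2 / yamabeExp (m + n) * ((m : ℝ) / ((m : ℝ) + (n : ℝ) - 4)) *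
            U z ^ yamabeExp (m + n) - U z ^ 2) * ‖z‖ ^ 2) := by
  obtain ⟨k, rfl⟩ : ∃ k, n = k + 1 := ⟨n - 1, by omega⟩
  obtain ⟨u, v, h, hr, hgrad⟩ := hU.exists_profile
  have hgrad2 : (fun z => v ‖z‖ ^ 2 * ‖z‖ ^ 2) =ᵐ[volume] fun z => ‖∇ U z‖ ^ 2 * ‖z‖ ^ 2 := by
    filter_upwards [hgrad] with z hz
    rw [hz]
  have weight : ∀ f : ℝ → ℝ, (fun r => r ^ k * (f r * r ^ 2)) = fun r => r ^ (k + 2) * f r :=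
    fun f => funext fun r => by ring
  have hG : ∫ z, ‖∇ U z‖ ^ 2 * ‖z‖ ^ 2 =
      unitSphereArea k * ∫ r in Ioi 0, r ^ (k + 2) * v r ^ 2 := by
    rw [← integral_congr_ae hgrad2, integral_radial fun r => v r ^ 2 * r ^ 2, weight]
  have hA : ∫ z, U z ^ 2 = unitSphereArea k * ∫ r in Ioi 0, r ^ k * u r ^ 2 := by
    simp only [hr]
    exact integral_radial fun r => u r ^ 2
  have hiG : 2 < yamabeExp (m + (k + 1)) →
      Integrable (fun z => ‖∇ U z‖ ^ 2 * ‖z‖ ^ 2) volume := by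
    intro hq
    refine Integrable.congr ?_ hgrad2
    rw [integrable_radial_iff (f := fun r => v r ^ 2 * r ^ 2), weight]
    exact h.integrableOn_pow_mul_deriv_sq hq _
  have hc := unitSphereArea_pos (k := k)
  rw [yamabeBeta, hG, hA]
  constructor
  · intro hmn
    have hq := two_lt_yamabeExp (N := m + (k + 1)) (by omega)
    refine ⟨hiG hq, ?_⟩
    have e1 := h.integral_mul_self_identity hq
    have e2 := h.integral_pohozaev_identity hq
    have hP := h.integral_pow_mul_rpow_pos hq (k + 2)
    have hk : (k : ℝ) < 3 := by exact_mod_cast (by omega : k < 3)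
    have hk0 : (0 : ℝ) ≤ k := Nat.cast_nonneg k
    have ha : yamabeConst (m + (k + 1)) = 6 := by rw [hmn]; norm_num [yamabeConst]
    have hp : yamabeExp (m + (k + 1)) = 4 := by rw [hmn]; norm_num [yamabeExp]
    rw [ha]
    rw [hp] at e1 e2 hP
    generalize (∫ r in Ioi 0, r ^ (k + 2) * v r ^ 2) = G at *
    generalize (∫ r in Ioi 0, r ^ (k + 2) * u r ^ 2) = Q at *
    generalize (∫ r in Ioi 0, r ^ (k + 2) * u r ^ (4 : ℝ)) = P at *
    generalize (∫ r in Ioi 0, r ^ k * u r ^ 2) = A at *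
    have key : unitSphereArea k * A - 6 / (((k + 1 : ℕ) : ℝ) * (((k + 1 : ℕ) : ℝ) + 2)) *
        (unitSphereArea k * G) = -(unitSphereArea k * P / (2 * ((k : ℝ) + 1))) := by
      push_cast
      field_simp
      linear_combination (-2 * ((k : ℝ) + 1 + 2)) * e1 + 2 * e2
    rw [key]
    have : 0 < unitSphereArea k * P / (2 * ((k : ℝ) + 1)) := by positivity
    linarith
  · intro hn4 hmn
    have hq := two_lt_yamabeExp (N := m + (k + 1)) (by omega)
    have hQ : Integrable (fun z => U z ^ 2 * ‖z‖ ^ 2) volume := by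
      simp only [hr]
      rw [integrable_radial_iff (f := fun r => u r ^ 2 * r ^ 2), weight]
      exact h.integrableOn_pow_mul_sq hq _
    have hP : Integrable (fun z => U z ^ yamabeExp (m + (k + 1)) * ‖z‖ ^ 2) volume := by
      simp only [hr]
      rw [integrable_radial_iff (f := fun r => u r ^ yamabeExp (m + (k + 1)) * r ^ 2),
        weight fun r => u r ^ yamabeExp (m + (k + 1))]
      exact h.integrableOn_pow_mul_rpow hq _
    refine ⟨hiG hq, hQ, hP, ?_⟩
    have e1 := h.integral_mul_self_identity hq
    have e2 := h.integral_pohozaev_identity hq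
    have hsplit : ∀ c : ℝ, ∫ z, (c * U z ^ yamabeExp (m + (k + 1)) - U z ^ 2) * ‖z‖ ^ 2 =
        unitSphereArea k * (c * (∫ r in Ioi 0, r ^ (k + 2) * u r ^ yamabeExp (m + (k + 1))) -
          ∫ r in Ioi 0, r ^ (k + 2) * u r ^ 2) := by
      intro c
      simp only [sub_mul, mul_assoc]
      rw [integral_sub (hP.const_mul c) hQ, integral_const_mul]
      simp only [hr]
      rw [integral_radial fun r => u r ^ 2 * r ^ 2,
        integral_radial fun r => u r ^ yamabeExp (m + (k + 1)) * r ^ 2,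
        weight fun r => u r ^ 2, weight fun r => u r ^ yamabeExp (m + (k + 1))]
      ring
    rw [hsplit]
    generalize (∫ r in Ioi 0, r ^ (k + 2) * v r ^ 2) = G at *
    generalize (∫ r in Ioi 0, r ^ (k + 2) * u r ^ 2) = Q at *
    generalize (∫ r in Ioi 0, r ^ (k + 2) * u r ^ yamabeExp (m + (k + 1))) = P at *
    generalize (∫ r in Ioi 0, r ^ k * u r ^ 2) = A at *
    have hmn' : (4 : ℝ) < m + (k + 1) := by exact_mod_cast hmn
    have hk3 : (k : ℝ) - 3 ≠ 0 := sub_ne_zero.2 (by exact_mod_cast (by omega : k ≠ 3))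
    have hN2 : (m : ℝ) + (k + 1) - 2 ≠ 0 := by linarith
    have hN4 : (m : ℝ) + (k + 1) - 4 ≠ 0 := by linarith
    have hN : (m : ℝ) + (k + 1) ≠ 0 := by linarith
    have hk1 : (k : ℝ) + 1 ≠ 0 := by positivity
    have hA' : A = (G + Q - P) / ((k : ℝ) + 1) := by
      field_simp
      linarith
    have hG' : G = ((k : ℝ) + 3) * (2 / yamabeExp (m + (k + 1)) * P - Q) / ((k : ℝ) - 3) := by
      rw [eq_div_iff hk3]
      linarith
    rw [hA', hG', yamabeExp, yamabeConst]
    push_cast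
    rw [show (k : ℝ) + 1 - 4 = k - 3 by ring, show (k : ℝ) + 1 + 2 = k + 3 by ring]
    field_simp
    ring
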